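/- Let $X$ be an infinite set. For $n\ge 1$ let $\mathcal O^{(n)}$ be the set of all functions $X^n\to X$, and let $\mathcal O=\bigcup_{n\ge 1}\mathcal O^{(n)}$. A clone on $X$ is a subset of $\mathcal O$ that contains all projections $(x_1,\dots,x_n)\mapsto x_k$ and is closed under composition of functions. It is precomplete if it is a dual atom of the lattice of all clones on $X$ (ordered by inclusion), and symmetric if it is closed under conjugation by permutations, i.e. $\mathcal C=\{\gamma^{-1}(f(\gamma(x_1),\dots,\gamma(x_n))) : f\in\mathcal C,\ \gamma \text{ a permutation of } X\}$. A set $S\subseteq X$ is large if $|S|=|X|$ and small otherwise; it is co-large (co-small) if $X\setminus S$ is large (small). A set $\mathcal H\subseteq\mathcal O$ has the co-large approximation property if for all $n\ge 1$, all $f\in\mathcal O^{(n)}$ and all co-large $S\subseteq X$ there is an $n$-ary $g\in\mathcal H$ with $g\upharpoonright_{S^n}=f\upharpoonright_{S^n}$. A function $f\in\mathcal O^{(1)}$ is almost surjective if its range contains a co-small set. Let $\mathcal E$ be the set of all almost surjective functions in $\mathcal O^{(1)}$, and $\mathcal F$ the set of all functions in $\mathcal O^{(1)}$ that are almost surjective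 or constant. For $\mathcal G\subseteq\mathcal O^{(1)}$ let $\mathrm{Pol}(\mathcal G)$ be the clone of all $f\in\mathcal O$ such that $f(g_1,\dots,g_n)\in\mathcal G$ for all $g_1,\dots,g_n\in\mathcal G$, where $n$ is the arity of $f$. Then a clone $\mathcal C$ on $X$ is symmetric, precomplete and has the co-large approximation property if and only if $\mathcal C=\mathrm{Pol}(\mathcal E)$ or $\mathcal C=\mathrm{Pol}(\mathcal F)$. -/

import Mathlib

namespace SymmetricClones

open Cardinal

universe u

/-- The operations on `X` of finite arity `n ≥ 1`. -/
abbrev Operation (X : Type u) : Type u :=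
  Σ n : ℕ+, ((Fin (n : ℕ) → X) → X)

/-- A clone on `X`: a set of finitary operations which contains all projections and is closed
under composition `f(g₁, …, gₙ)`, where `f` is `n`-ary and all `gᵢ` have the same arity `m`. -/
@[ext]
structure Clone (X : Type u) where
  carrier : Set (Operation X)
  proj_mem : ∀ (n : ℕ+) (k : Fin (n : ℕ)), ⟨n, fun x => x k⟩ ∈ carrier
  comp_mem : ∀ (n m : ℕ+) (f : (Fin (n : ℕ) → X) → X)
    (g : Fin (n : ℕ) → (Fin (m : ℕ) → X) → X),
    ⟨n, f⟩ ∈ carrier → (∀ i, ⟨m, g i⟩ ∈ carrier) → ⟨m, fun x => f fun i => g i x⟩ ∈ carrier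

variable {X : Type u}

/-- Clones are ordered by inclusion. -/
instance : PartialOrder (Clone X) where
  le C D := C.carrier ⊆ D.carrier
  le_refl _ := subset_rfl
  le_trans _ _ _ h₁ h₂ := Set.Subset.trans h₁ h₂
  le_antisymm _ _ h₁ h₂ := Clone.ext (Set.Subset.antisymm h₁ h₂)

/-- The largest clone consists of all operations. -/
instance : OrderTop (Clone X) where
  top := ⟨Set.univ, fun _ _ => trivial, fun _ _ _ _ _ _ => trivial⟩
  le_top _ := Set.subset_univ _

/-- A clone is precomplete iff it is a dual atom in the lattice of clones. -/
def Precomplete (C : Clone X) : Prop :=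
  IsCoatom C

/-- The conjugate `γ⁻¹(f(γ(x₁), …, γ(xₙ)))` of an operation `f` by a permutation `γ`. -/
def conj (γ : Equiv.Perm X) (f : Operation X) : Operation X :=
  ⟨f.1, fun x => γ.symm (f.2 fun i => γ (x i))⟩

/-- A clone is symmetric iff it equals the set of all conjugates of its members. -/
def IsSymmetric (C : Clone X) : Prop :=
  C.carrier = {h | ∃ f ∈ C.carrier, ∃ γ : Equiv.Perm X, h = conj γ f}

/-- The polymorphisms of a set `G` of unary functions. -/
def pol (G : Set (X → X)) : Clone X where
  carrier := {f | ∀ g : Fin (f.1 : ℕ) → X → X, (∀ i, g i ∈ G) → (fun x => f.2 fun i => g i x) ∈ G}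
  proj_mem _ k _ hg := hg k
  comp_mem _ _ _ g hf hg a ha := hf (fun i x => g i fun j => a j x) fun i => hg i a ha

/-- A subset of `X` is large iff it has the cardinality of `X`. -/
def Large (S : Set X) : Prop :=
  #S = #X

def Small (S : Set X) : Prop :=
  ¬ Large S

def CoLarge (S : Set X) : Prop :=
  Large Sᶜ

def CoSmall (S : Set X) : Prop :=
  Small Sᶜ

/-- A property holds for almost all `x` iff it holds for all `x` in some co-small set. -/
def AlmostAll (p : X → Prop) : Prop :=
  ∃ S : Set X, CoSmall S ∧ ∀ x ∈ S, p x

def AlmostSurjective (f : X → X) : Prop :=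
  AlmostAll fun x => x ∈ Set.range f

/-- The set `ℰ` of almost surjective functions. -/
def setE (X : Type u) : Set (X → X) :=
  {f | AlmostSurjective f}

/-- The set `ℱ` of functions that are almost surjective or constant. -/
def setF (X : Type u) : Set (X → X) :=
  {f | AlmostSurjective f ∨ ∃ c, ∀ x, f x = c}

/-- The `n`-ary co-large approximation property of a set of operations. -/
def NAryCoLargeApprox (n : ℕ+) (H : Set (Operation X)) : Prop :=
  ∀ (f : (Fin (n : ℕ) → X) → X) (S : Set X), CoLarge S →
    ∃ g : (Fin (n : ℕ) → X) → X, ⟨n, g⟩ ∈ H ∧ ∀ x, (∀ i, x i ∈ S) → g x = f x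

/-- The co-large approximation property of a set of operations. -/
def CoLargeApprox (H : Set (Operation X)) : Prop :=
  ∀ n : ℕ+, NAryCoLargeApprox n H

end SymmetricClones

namespace SymmetricClones

open Cardinal

universe u

section

variable {X : Type u}

/-! ### Small and large sets -/

/-! The engine is `eq_top_of_large_coLarge_range`: under co-large approximation, a single unary
member whose range is both large and co-large generates every operation. In a proper clone of this
kind each unary function is therefore almost surjective or has small range.

The two polymorphism clones have the approximation property because a partial operation on Sⁿ can be
extended by a map that sends the complement of S onto X. Anything strictly above them contains a
unary function outside `setE` or `setF`, and from it a function of large co-large range is built.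

Conversely, let C be symmetric and precomplete with the approximation property. Precompleteness is
used through C = pol G: any G preserved by C with pol G proper describes C exactly. Choosing G as
functions that enter C after composition with surjections, exactly or up to a small set, puts first
all permutations with large fixed-point set and then all of `setE` into C. If C contains `setE` but
is not `pol (setE X)`, approximation yields all constants, so `setF` lies in C, and a further
function outside `setF` would generate everything. -/

theorem large_iff {S : Set X} : Large S ↔ #X ≤ #S :=
  ⟨fun h => h.ge, fun h => le_antisymm (mk_set_le S) h⟩

theorem small_iff {S : Set X} : Small S ↔ #S < #X := by
  rw [Small, large_iff, not_le]

theorem not_small {S : Set X} : ¬ Small S ↔ Large S := not_not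

theorem Large.mono {S T : Set X} (h : Large S) (hST : S ⊆ T) : Large T :=
  large_iff.2 ((large_iff.1 h).trans (mk_le_mk_of_subset hST))

theorem Small.mono {S T : Set X} (h : Small T) (hST : S ⊆ T) : Small S :=
  fun hS => h (hS.mono hST)

theorem large_univ : Large (Set.univ : Set X) := mk_univ

theorem Small.image {S : Set X} (h : Small S) (f : X → X) : Small (f '' S) :=
  small_iff.2 (mk_image_le.trans_lt (small_iff.1 h))

theorem large_range_of_injective {f : X → X} (hf : Function.Injective f) : Large (Set.range f) :=
  mk_range_eq f hf

theorem Large.image {S : Set X} (h : Large S) {f : X → X} (hf : Set.InjOn f S) :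
    Large (f '' S) :=
  (mk_image_eq_of_injOn f S hf).trans h

theorem Large.exists_injective_range_eq {S : Set X} (h : Large S) :
    ∃ φ : X → X, Function.Injective φ ∧ Set.range φ = S := by
  obtain ⟨e⟩ := Cardinal.eq.1 h
  refine ⟨fun x => e.symm x, Subtype.val_injective.comp e.symm.injective, ?_⟩
  ext y
  exact ⟨fun ⟨x, hx⟩ => hx ▸ (e.symm x).2, fun hy => ⟨e ⟨y, hy⟩, by simp⟩⟩

/-- A large set can be mapped onto the whole space. -/
theorem Large.exists_surj {S : Set X} (h : Large S) :
    ∃ φ : X → X, ∀ y, ∃ x ∈ S, φ x = y := by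
  obtain ⟨ψ, hψ, hr⟩ := h.exists_injective_range_eq
  rcases isEmpty_or_nonempty X with hX | hX
  · exact ⟨id, fun y => (IsEmpty.false y).elim⟩
  · exact ⟨Function.invFun ψ, fun y => ⟨ψ y, hr ▸ ⟨y, rfl⟩, Function.leftInverse_invFun hψ y⟩⟩

/-! ### Almost surjective functions -/

theorem mem_setE {f : X → X} : f ∈ setE X ↔ Small (Set.range f)ᶜ :=
  ⟨fun ⟨_, hS, h⟩ => Small.mono hS (Set.compl_subset_compl.2 h), fun h => ⟨_, h, fun _ hx => hx⟩⟩

theorem not_mem_setE {f : X → X} : f ∉ setE X ↔ CoLarge (Set.range f) := by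
  rw [mem_setE, not_small]; rfl

/-- If `h` maps the complement of `S` onto `X` then `w`, which is `h ∘ y` wherever `y` avoids `S`,
inherits almost surjectivity from `y`. -/
theorem setE_of_eq_off {y w h : X → X} {S : Set X} (hy : y ∈ setE X)
    (hh : ∀ z, ∃ s ∈ Sᶜ, h s = z) (hw : ∀ t, y t ∉ S → w t = h (y t)) : w ∈ setE X := by
  rw [mem_setE] at *
  refine (hy.image h).mono fun z hz => ?_
  obtain ⟨s, hs, rfl⟩ := hh z
  refine ⟨s, ?_, rfl⟩
  rintro ⟨t, rfl⟩
  exact hz ⟨t, hw t hs⟩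

/-! ### Unary members of a clone -/

/-- The unary functions in a clone. -/
def unary (C : Clone X) : Set (X → X) :=
  {u | (⟨1, fun x => u (x 0)⟩ : Operation X) ∈ C.carrier}

theorem Clone.comp_unary {C : Clone X} {n : ℕ+} {f : (Fin (n : ℕ) → X) → X}
    (hf : (⟨n, f⟩ : Operation X) ∈ C.carrier) {u : Fin (n : ℕ) → X → X}
    (hu : ∀ i, u i ∈ unary C) : (fun x => f fun i => u i x) ∈ unary C :=
  C.comp_mem n 1 f (fun i x => u i (x 0)) hf hu

theorem Clone.unary_comp_mem {C : Clone X} {n : ℕ+} {f : (Fin (n : ℕ) → X) → X}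
    (hf : (⟨n, f⟩ : Operation X) ∈ C.carrier) {u : X → X}
    (hu : u ∈ unary C) : (⟨n, fun x => u (f x)⟩ : Operation X) ∈ C.carrier :=
  C.comp_mem 1 n (fun x => u (x 0)) (fun _ => f) hu fun _ => hf

theorem id_mem_unary (C : Clone X) : id ∈ unary C := C.proj_mem 1 0

theorem comp_mem_unary {C : Clone X} {u v : X → X} (hu : u ∈ unary C) (hv : v ∈ unary C) :
    u ∘ v ∈ unary C :=
  C.unary_comp_mem (n := 1) hv hu

theorem Clone.comp_unary_pair {C : Clone X} {f : (Fin 2 → X) → X}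
    (hf : (⟨2, f⟩ : Operation X) ∈ C.carrier) {u v : X → X} (hu : u ∈ unary C)
    (hv : v ∈ unary C) : (fun x => f ![u x, v x]) ∈ unary C := by
  have := C.comp_unary hf (u := ![u, v]) (fun i => by
    change Fin 2 at i
    fin_cases i
    · exact hu
    · exact hv)
  refine (congrArg (· ∈ unary C) (funext fun x => congrArg f ?_)).mp this
  funext i
  change Fin 2 at i
  fin_cases i <;> rfl

theorem le_pol_unary (C : Clone X) : C ≤ pol (unary C) := fun _ hf _ hg =>
  C.comp_unary hf hg

theorem mem_unary_pol {G : Set (X → X)} {u : X → X} :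
    u ∈ unary (pol G) ↔ ∀ g ∈ G, u ∘ g ∈ G :=
  ⟨fun h g hg => h (fun _ => g) fun _ => hg, fun h g hg => h (g 0) (hg 0)⟩

theorem unary_mono {C D : Clone X} (h : C ≤ D) : unary C ⊆ unary D := fun _ hu => h hu

theorem eq_top_iff_forall {C : Clone X} :
    C = ⊤ ↔ ∀ (n : ℕ+) (f : (Fin (n : ℕ) → X) → X), (⟨n, f⟩ : Operation X) ∈ C.carrier :=
  ⟨fun h _ _ => h ▸ trivial, fun h => top_unique fun f _ => h f.1 f.2⟩

theorem CoLargeApprox.unary {C : Clone X} (hC : CoLargeApprox C.carrier) (f : X → X) {S : Set X}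
    (hS : CoLarge S) : ∃ g ∈ unary C, ∀ x ∈ S, g x = f x := by
  obtain ⟨g, hg, h⟩ := hC 1 (fun x => f (x 0)) S hS
  refine ⟨fun x => g fun _ => x, ?_, fun x hx => h _ fun _ => hx⟩
  exact C.comp_mem 1 1 g (fun _ x => x 0) hg fun _ => C.proj_mem 1 0

theorem CoLargeApprox.binary {C : Clone X} (hC : CoLargeApprox C.carrier) (f : X → X → X)
    {S : Set X} (hS : CoLarge S) :
    ∃ g : X → X → X, (∀ x ∈ S, ∀ y ∈ S, g x y = f x y) ∧
      ∀ u ∈ SymmetricClones.unary C, ∀ v ∈ SymmetricClones.unary C,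
        (fun x => g (u x) (v x)) ∈ SymmetricClones.unary C := by
  obtain ⟨g, hg, h⟩ := hC 2 (fun x => f (x (0 : Fin 2)) (x (1 : Fin 2))) S hS
  refine ⟨fun x y => g ![x, y], fun x hx y hy => h _ fun i => ?_, fun u hu v hv =>
    C.comp_unary_pair hg hu hv⟩
  change Fin 2 at i
  fin_cases i
  · exact hx
  · exact hy

theorem CoLargeApprox.mono {C D : Clone X} (hC : CoLargeApprox C.carrier) (h : C ≤ D) :
    CoLargeApprox D.carrier := fun _ _ S hS =>
  let ⟨g, hg, hh⟩ := hC _ _ S hS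
  ⟨g, h hg, hh⟩

/-- A clone with the co-large approximation property is everything as soon as finitely many of its
unary functions with values in a common co-large set are jointly injective. -/
theorem eq_top_of_jointly_injective {C : Clone X} (hC : CoLargeApprox C.carrier) {m : ℕ+}
    {u : Fin (m : ℕ) → X → X} (hu : ∀ j, u j ∈ unary C) {S : Set X} (hS : CoLarge S)
    (hmem : ∀ j x, u j x ∈ S) (hinj : Function.Injective fun x j => u j x) : C = ⊤ := by
  rw [eq_top_iff_forall]
  intro n F
  -- Each of the n arguments is replaced by its m values in S, so F factors through an injective
  -- code into a power of S, where approximation applies.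
  let code : (Fin (n : ℕ) → X) → (Fin ((n * m : ℕ+) : ℕ) → X) := fun x k =>
    u (finProdFinEquiv.symm k).2 (x (finProdFinEquiv.symm k).1)
  have hcode : Function.Injective code := by
    intro x y hxy
    ext i
    apply hinj
    ext j
    simpa [code] using congrFun hxy (finProdFinEquiv (i, j))
  rcases isEmpty_or_nonempty X with hX | hX
  · have : F = fun x => x ⟨0, n.pos⟩ := funext fun x => (IsEmpty.false (x ⟨0, n.pos⟩)).elim
    rw [this]
    exact C.proj_mem n _
  obtain ⟨g, hg, h⟩ := hC (n * m) (fun y => F (Function.invFun code y)) S hS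
  have : F = fun x => g (code x) := by
    ext x
    rw [h (code x) fun k => hmem _ _, Function.leftInverse_invFun hcode x]
  rw [this]
  exact C.comp_mem (n * m) n g (fun k x => code x k) hg fun k =>
    C.unary_comp_mem (C.proj_mem n _) (hu _)

/-! ### Consequences of the infinity of the base set -/

variable [Infinite X]

theorem Small.union {S T : Set X} (hS : Small S) (hT : Small T) : Small (S ∪ T) :=
  small_iff.2 ((mk_union_le S T).trans_lt
    (add_lt_of_lt (aleph0_le_mk X) (small_iff.1 hS) (small_iff.1 hT)))

theorem small_of_finite {S : Set X} (hS : S.Finite) : Small S :=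
  small_iff.2 (hS.lt_aleph0.trans_le (aleph0_le_mk X))

theorem Small.biUnion_finset {ι : Type*} (s : Finset ι) {A : ι → Set X}
    (h : ∀ i ∈ s, Small (A i)) : Small (⋃ i ∈ s, A i) := by
  classical
  induction s using Finset.induction_on with
  | empty => simpa using small_of_finite Set.finite_empty
  | insert a s ha ih =>
    rw [Finset.set_biUnion_insert]
    exact (h a (by simp)).union (ih fun i hi => h i (by simp [hi]))

theorem Large.diff {S T : Set X} (hS : Large S) (hT : Small T) : Large (S \ T) := by
  by_contra h
  exact (Small.union h hT) (hS.mono (by intro x hx; by_cases hxT : x ∈ T <;> simp [hx, hxT]))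

theorem Small.coLarge {S : Set X} (hS : Small S) : CoLarge S := by
  have := large_univ.diff hS
  rwa [← Set.compl_eq_univ_sdiff] at this

theorem Large.exists_split {S : Set X} (h : Large S) :
    ∃ A B : Set X, A ⊆ S ∧ B ⊆ S ∧ Disjoint A B ∧ A ∪ B = S ∧ Large A ∧ Large B := by
  obtain ⟨φ, hφ, rfl⟩ := h.exists_injective_range_eq
  have hc : #X = #(X ⊕ X) := by simp [add_eq_self (aleph0_le_mk X)]
  obtain ⟨e⟩ := Cardinal.eq.1 hc
  refine ⟨Set.range fun x => φ (e.symm (.inl x)), Set.range fun x => φ (e.symm (.inr x)),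
    ?_, ?_, ?_, ?_, ?_, ?_⟩
  · rintro _ ⟨x, rfl⟩; exact ⟨_, rfl⟩
  · rintro _ ⟨x, rfl⟩; exact ⟨_, rfl⟩
  · rw [Set.disjoint_left]
    rintro _ ⟨x, rfl⟩ ⟨y, hy⟩
    simpa using e.symm.injective (hφ hy)
  · ext y
    constructor
    · rintro (⟨x, rfl⟩ | ⟨x, rfl⟩) <;> exact ⟨_, rfl⟩
    · rintro ⟨x, rfl⟩
      rcases hx : e x with a | a
      · exact .inl ⟨a, by simp [← hx]⟩
      · exact .inr ⟨a, by simp [← hx]⟩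
  · exact large_range_of_injective
      (hφ.comp (e.symm.injective.comp Sum.inl_injective))
  · exact large_range_of_injective
      (hφ.comp (e.symm.injective.comp Sum.inr_injective))

/-- The set is split into three large pieces. -/
theorem exists_three_large :
    ∃ A B C : Set X, Disjoint A B ∧ Disjoint A C ∧ Disjoint B C ∧ A ∪ B ∪ C = Set.univ ∧
      Large A ∧ Large B ∧ Large C := by
  obtain ⟨A, T, -, -, hAT, hu, hA, hT⟩ := (large_univ (X := X)).exists_split
  obtain ⟨B, C, hBT, hCT, hBC, hu', hB, hC⟩ := hT.exists_split
  exact ⟨A, B, C, hAT.mono_right hBT, hAT.mono_right hCT, hBC, by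
    rw [Set.union_assoc, hu', hu], hA, hB, hC⟩

theorem exists_injective_coLarge :
    ∃ ι : X → X, Function.Injective ι ∧ CoLarge (Set.range ι) := by
  obtain ⟨A, B, -, -, hAB, hu, hA, hB⟩ := (large_univ (X := X)).exists_split
  obtain ⟨φ, hφ, rfl⟩ := hA.exists_injective_range_eq
  exact ⟨φ, hφ, hB.mono fun x hx hx' => Set.disjoint_left.1 hAB hx' hx⟩

theorem mem_setE_of_surjective {f : X → X} (hf : Function.Surjective f) : f ∈ setE X := by
  rw [mem_setE, hf.range_eq, Set.compl_univ]
  exact small_of_finite Set.finite_empty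

theorem setE_comp {e f : X → X} (he : e ∈ setE X) (hf : f ∈ setE X) : e ∘ f ∈ setE X := by
  rw [mem_setE] at *
  refine (he.union (hf.image e)).mono fun z hz => ?_
  by_cases h : z ∈ Set.range e
  · obtain ⟨y, rfl⟩ := h
    exact .inr ⟨y, fun ⟨x, hx⟩ => hz ⟨x, by simp [hx]⟩, rfl⟩
  · exact .inl h

theorem setF_comp {e f : X → X} (he : e ∈ setF X) (hf : f ∈ setF X) : e ∘ f ∈ setF X := by
  rcases he with he | ⟨c, hc⟩
  · rcases hf with hf | ⟨c, hc⟩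
    · exact .inl (setE_comp he hf)
    · exact .inr ⟨e c, fun x => by simp [hc]⟩
  · exact .inr ⟨c, fun x => hc _⟩

/-- A section of u over its range makes u ∘ σ an injection φ. The clone only sees σ off a large set
T, so three disjoint choices of T are used: two points meet at most two of them, and the remaining
approximation gives φ at both. -/
theorem eq_top_of_large_coLarge_range {C : Clone X} (hC : CoLargeApprox C.carrier) {u : X → X}
    (hu : u ∈ unary C) (h₁ : Large (Set.range u)) (h₂ : CoLarge (Set.range u)) : C = ⊤ := by
  obtain ⟨φ, hφ, hr⟩ := h₁.exists_injective_range_eq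
  have : ∀ x, ∃ y, u y = φ x := fun x => by
    have : φ x ∈ Set.range u := hr ▸ ⟨x, rfl⟩
    exact this
  choose σ hσ using this
  have key : ∀ T : Set X, Large T → ∃ g ∈ unary C, ∀ x ∉ T, u (g x) = φ x := by
    intro T hT
    obtain ⟨g, hg, h⟩ := hC.unary σ (S := Tᶜ) (by rwa [CoLarge, compl_compl])
    exact ⟨g, hg, fun x hx => by rw [h x hx, hσ]⟩
  obtain ⟨A, B, D, hAB, hAD, hBD, -, hA, hB, hD⟩ := exists_three_large (X := X)
  obtain ⟨a, ha, ha'⟩ := key A hA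
  obtain ⟨b, hb, hb'⟩ := key B hB
  obtain ⟨d, hd, hd'⟩ := key D hD
  refine eq_top_of_jointly_injective hC (m := 3) (u := ![u ∘ a, u ∘ b, u ∘ d]) ?_ h₂ ?_ ?_
  · intro j
    change Fin 3 at j
    fin_cases j
    · exact (comp_mem_unary hu ha :)
    · exact (comp_mem_unary hu hb :)
    · exact (comp_mem_unary hu hd :)
  · intro j x
    change Fin 3 at j
    fin_cases j <;> exact ⟨_, rfl⟩
  · intro x y hxy
    have h0 : u (a x) = u (a y) := congrFun hxy (0 : Fin 3)
    have h1 : u (b x) = u (b y) := congrFun hxy (1 : Fin 3)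
    have h2 : u (d x) = u (d y) := congrFun hxy (2 : Fin 3)
    rw [Set.disjoint_left] at hAB hAD hBD
    apply hφ
    by_cases hxA : x ∈ A <;> by_cases hyA : y ∈ A <;> by_cases hxB : x ∈ B <;>
      by_cases hyB : y ∈ B <;> by_cases hxD : x ∈ D <;> by_cases hyD : y ∈ D <;> grind

end

section

variable {X : Type u}

/-! ### The clones `pol (setE X)` and `pol (setF X)` -/

theorem isSymmetric_pol {G : Set (X → X)}
    (hG : ∀ γ : Equiv.Perm X, ∀ g ∈ G, γ.symm ∘ g ∘ γ ∈ G) : IsSymmetric (pol G) := by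
  have key : ∀ f ∈ (pol G).carrier, ∀ γ : Equiv.Perm X, conj γ f ∈ (pol G).carrier := by
    intro f hf γ g hg
    have := hG γ _ (hf (fun i => γ ∘ g i ∘ γ.symm) fun i => hG γ.symm _ (hg i))
    convert this using 1
    ext x
    simp [conj]
  ext f
  refine ⟨fun hf => ⟨conj 1 f, key f hf 1, 1, rfl⟩, ?_⟩
  rintro ⟨f, hf, γ, rfl⟩
  exact key f hf γ

theorem setE_conj (γ : Equiv.Perm X) {g : X → X} (hg : g ∈ setE X) : γ.symm ∘ g ∘ γ ∈ setE X := by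
  rw [mem_setE] at *
  refine (hg.image γ.symm).mono fun z hz => ⟨γ z, ?_, by simp⟩
  rintro ⟨x, hx⟩
  exact hz ⟨γ.symm x, by simp [hx]⟩

theorem isSymmetric_pol_setE : IsSymmetric (pol (setE X)) :=
  isSymmetric_pol fun γ _ => setE_conj γ

theorem isSymmetric_pol_setF : IsSymmetric (pol (setF X)) :=
  isSymmetric_pol fun γ _ hg => hg.imp (setE_conj γ) fun ⟨c, hc⟩ =>
    ⟨γ.symm c, fun x => by simp [hc]⟩

/-- The extension of `f ↾ Sⁿ` which applies `h` to the first argument outside `S`. -/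
theorem exists_extension {n : ℕ} (f : (Fin n → X) → X) (S : Set X) (h : X → X) :
    ∃ g : (Fin n → X) → X, (∀ x, (∀ i, x i ∈ S) → g x = f x) ∧
      ∀ x i, x i ∉ S → (∀ j < i, x j ∈ S) → g x = h (x i) := by
  have : ∀ x : Fin n → X, ∃ z, ((∀ i, x i ∈ S) → z = f x) ∧
      ∀ i, x i ∉ S → (∀ j < i, x j ∈ S) → z = h (x i) := by
    intro x
    by_cases hx : ∀ i, x i ∈ S
    · exact ⟨f x, fun _ => rfl, fun i hi => (hi (hx i)).elim⟩
    · have hne : {i | x i ∉ S}.Nonempty := by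
        push Not at hx
        exact hx
      set i₀ := WellFounded.min (wellFounded_lt (α := Fin n)) _ hne with hi₀
      have h₁ : x i₀ ∉ S := WellFounded.min_mem (wellFounded_lt (α := Fin n)) _ hne
      refine ⟨h (x i₀), fun h' => (hx h').elim, fun i hi hj => ?_⟩
      rcases lt_trichotomy i₀ i with hlt | heq | hlt
      · exact (h₁ (hj _ hlt)).elim
      · rw [heq]
      · exact (WellFounded.not_lt_min (wellFounded_lt (α := Fin n)) {i | x i ∉ S} hi hlt).elim
  choose g hg using this
  exact ⟨g, fun x => (hg x).1, fun x => (hg x).2⟩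

theorem coLargeApprox_pol_setE : CoLargeApprox (pol (setE X)).carrier := by
  intro n f S hS
  obtain ⟨h, hh⟩ := Large.exists_surj hS
  obtain ⟨g, hg, hg'⟩ := exists_extension f S h
  refine ⟨g, fun a ha => ?_, hg⟩
  let i₀ : Fin (n : ℕ) := ⟨0, n.pos⟩
  exact setE_of_eq_off (ha i₀) hh fun t ht => hg' _ i₀ ht fun j hj =>
    (Nat.not_lt_zero _ (Fin.lt_def.1 hj)).elim

theorem coLargeApprox_pol_setF : CoLargeApprox (pol (setF X)).carrier := by
  intro n f S hS
  obtain ⟨h, hh⟩ := Large.exists_surj hS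
  obtain ⟨g, hg, hg'⟩ := exists_extension f S h
  refine ⟨g, fun (a : Fin (n : ℕ) → X → X) ha => ?_, hg⟩
  change (fun x => g fun i => a i x) ∈ setF X
  by_cases hc : ∀ i, ∃ c ∈ S, ∀ x, a i x = c
  · choose c _ hc using hc
    exact .inr ⟨g c, fun x => congrArg g (funext fun i => hc i x)⟩
  · have hne : {i | ¬ ∃ c ∈ S, ∀ x, a i x = c}.Nonempty := by
      by_contra h
      exact hc fun i => by_contra fun hi => h ⟨i, hi⟩
    -- All arguments before i₀ are constants in S, so wherever argument i₀ leaves S it is the first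
    -- to do so and g acts on it by h.
    set i₀ := WellFounded.min (wellFounded_lt (α := Fin (n : ℕ))) _ hne with hi₀
    have h₁ : ¬ ∃ c ∈ S, ∀ x, a i₀ x = c :=
      WellFounded.min_mem (wellFounded_lt (α := Fin (n : ℕ))) _ hne
    have h₂ : ∀ t, ∀ j < i₀, a j t ∈ S := fun t j hj => by
      by_contra hS'
      refine WellFounded.not_lt_min (wellFounded_lt (α := Fin (n : ℕ)))
        {i | ¬ ∃ c ∈ S, ∀ x, a i x = c} ?_ hj
      rintro ⟨c, hc, hc'⟩
      exact hS' (hc' t ▸ hc)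
    rcases ha i₀ with hE | ⟨c, hc⟩
    · exact .inl (setE_of_eq_off hE hh fun t ht => hg' _ i₀ ht (h₂ t))
    · have hcS : c ∉ S := fun h => h₁ ⟨c, h, hc⟩
      refine .inr ⟨h c, fun x => ?_⟩
      change g (fun i => a i x) = h c
      rw [hg' _ i₀ (by rwa [hc]) (h₂ x), hc]

theorem exists_not_mem_of_not_le_pol {C : Clone X} {G : Set (X → X)} (hG : G ⊆ unary C)
    (h : ¬ C ≤ pol G) : ∃ k ∈ unary C, k ∉ G := by
  by_contra! hC
  exact h fun f hf g hg => hC _ (C.comp_unary hf fun i => hG (hg i))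

variable [Infinite X]

theorem const_not_mem_setE (c : X) : (fun _ : X => c) ∉ setE X := by
  rw [not_mem_setE]
  exact (small_of_finite (Set.finite_range_const)).coLarge

theorem pol_setE_ne_top : pol (setE X) ≠ ⊤ := by
  obtain ⟨c⟩ := (inferInstance : Nonempty X)
  intro h
  exact const_not_mem_setE c ((mem_unary_pol (u := fun _ => c)).1
    (eq_top_iff_forall.1 h 1 fun _ => c) id (mem_setE_of_surjective Function.surjective_id))

theorem pol_setF_ne_top : pol (setF X) ≠ ⊤ := by
  obtain ⟨ι, hι, hr⟩ := exists_injective_coLarge (X := X)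
  intro h
  have := (mem_unary_pol (u := ι)).1 (eq_top_iff_forall.1 h 1 fun x => ι (x 0)) id
    (.inl (mem_setE_of_surjective Function.surjective_id))
  rcases this with h' | ⟨c, hc⟩
  · exact not_mem_setE.2 hr h'
  · obtain ⟨a, b, hab⟩ := exists_pair_ne X
    exact hab (hι ((hc a).trans (hc b).symm))

theorem setE_subset_unary_pol_setE : setE X ⊆ unary (pol (setE X)) := fun _ he =>
  mem_unary_pol.2 fun _ hg => setE_comp he hg

theorem setF_subset_unary_pol_setF : setF X ⊆ unary (pol (setF X)) := fun _ he =>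
  mem_unary_pol.2 fun _ hg => setF_comp he hg

theorem isCoatom_pol_setE : IsCoatom (pol (setE X)) := by
  refine ⟨pol_setE_ne_top, fun C hC => ?_⟩
  have happ := coLargeApprox_pol_setE.mono hC.le
  obtain ⟨k, hk, hkE⟩ := exists_not_mem_of_not_le_pol
    (setE_subset_unary_pol_setE.trans (unary_mono hC.le)) hC.not_ge
  rw [not_mem_setE] at hkE
  obtain ⟨h, hh⟩ := Large.exists_surj hkE
  obtain ⟨ι, hι, hr⟩ := exists_injective_coLarge (X := X)
  classical
  -- The second argument acts as a switch: almost surjective functions leave the range of k enough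
  -- to keep g in `pol (setE X)`, while k itself always selects the injection ι.
  let g : (Fin ((2 : ℕ+) : ℕ) → X) → X := fun x =>
    if x (1 : Fin 2) ∈ Set.range k then ι (x (0 : Fin 2)) else h (x (1 : Fin 2))
  have hg : (⟨2, g⟩ : Operation X) ∈ C.carrier := by
    apply hC.le
    intro a ha
    exact setE_of_eq_off (ha (1 : Fin 2)) hh fun t ht => if_neg ht
  have hu : (fun x => g (![x, k x])) ∈ unary C :=
    C.comp_unary_pair hg (id_mem_unary C) hk
  have : (fun x => g (![x, k x])) = ι := by
    ext x
    exact if_pos ⟨x, rfl⟩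
  rw [this] at hu
  exact eq_top_of_large_coLarge_range happ hu (large_range_of_injective hι) hr

/-! ### Clones above the almost surjective functions -/

/-- In a clone containing a nonconstant unary function with co-large range, some large co-large
set is separated from its complement by unary functions in the clone. -/
theorem exists_indicator {C : Clone X} (hC : CoLargeApprox C.carrier) {k : X → X}
    (hk : k ∈ unary C) (hr : CoLarge (Set.range k)) (hne : ∃ s t, k s ≠ k t) :
    ∃ S : Set X, Large S ∧ CoLarge S ∧
      ∀ a b, ∃ u ∈ unary C, (∀ x ∈ S, u x = a) ∧ ∀ x ∉ S, u x = b := by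
  obtain ⟨s, t, hst⟩ := hne
  obtain ⟨A, B, D, hAB, hAD, hBD, -, hA, hB, hD⟩ := exists_three_large (X := X)
  classical
  -- The values of d on D are uncontrolled, but k ∘ d stays in the co-large range of k, where j can
  -- sort them into a or b.
  obtain ⟨d, hd, hd'⟩ := hC.unary (fun x => if x ∈ A then s else t) (S := Dᶜ)
    (by rwa [CoLarge, compl_compl])
  rw [Set.disjoint_left] at hAB hAD hBD
  refine ⟨{x | k (d x) = k s}, hA.mono fun x hx => ?_, hB.mono fun x hx => ?_, fun a b => ?_⟩
  · simp [hd' x (hAD hx), hx]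
  · simp [hd' x (hBD hx), show x ∉ A from fun h => hAB h hx, hst.symm]
  · obtain ⟨j, hj, hj'⟩ := hC.unary (fun y => if y = k s then a else b) hr
    refine ⟨j ∘ k ∘ d, comp_mem_unary hj (comp_mem_unary hk hd), fun x hx => ?_, fun x hx => ?_⟩
    · have hx : k (d x) = k s := hx
      rw [Function.comp_apply, Function.comp_apply, hj' _ ⟨d x, rfl⟩, if_pos hx]
    · have hx : k (d x) ≠ k s := hx
      simp [hj' _ ⟨d x, rfl⟩, hx]

/-- If the clone contains `q` and a function `w` which is the identity on a large co-large set and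
agrees with `q` elsewhere, then `q` is almost surjective. -/
theorem mem_setE_of_mix {C : Clone X} (hC : CoLargeApprox C.carrier) (hne : C ≠ ⊤) {S : Set X}
    (hS : Large S) (hS' : CoLarge S) {q w : X → X} (hq : q ∈ unary C) (hw : w ∈ unary C)
    (h₁ : ∀ x ∈ S, w x = x) (h₂ : ∀ x ∉ S, w x = q x) : q ∈ setE X := by
  by_contra hE
  rw [not_mem_setE] at hE
  have hsmall : Small (Set.range q) := fun hl =>
    hne (eq_top_of_large_coLarge_range hC hq hl hE)
  refine hne (eq_top_of_large_coLarge_range hC hw (hS.mono fun x hx => ⟨x, h₁ x hx⟩) ?_)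
  have : Large (Sᶜ \ Set.range q) := Large.diff hS' hsmall
  refine this.mono ?_
  rintro x ⟨hx, hx'⟩ ⟨y, rfl⟩
  by_cases hy : y ∈ S
  · exact hx (by rwa [h₁ y hy])
  · exact hx' ⟨y, (h₂ y hy).symm⟩

/-- A binary f in C with neutral element o on S has almost surjective sections if C is proper. Hence
every row and every column contains a point whose value avoids a given large S₂ ⊆ S. A curve through
such points that meets all rows and columns has surjective coordinates, yet f along it misses S₂. -/
theorem eq_top_of_setE_subset {C : Clone X} (hC : CoLargeApprox C.carrier)
    (hE : setE X ⊆ unary C) {k : X → X} (hk : k ∈ unary C) (hkF : k ∉ setF X) : C = ⊤ := by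
  by_contra hne
  have hr : CoLarge (Set.range k) := not_mem_setE.1 fun h => hkF (.inl h)
  have hnc : ∃ s t, k s ≠ k t := by
    by_contra! h
    obtain ⟨s⟩ := (inferInstance : Nonempty X)
    exact hkF (.inr ⟨k s, fun x => h x s⟩)
  obtain ⟨S, hS, hS', hind⟩ := exists_indicator hC hk hr hnc
  have hconst : ∀ c, (fun _ => c) ∈ unary C := fun c => by
    obtain ⟨u, hu, h₁, h₂⟩ := hind c c
    have : u = fun _ => c := funext fun x => by
      by_cases hx : x ∈ S
      · exact h₁ x hx
      · exact h₂ x hx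
    exact this ▸ hu
  obtain ⟨S₁, S₂, hS₁, hS₂, hdisj, -, hl₁, hl₂⟩ := hS.exists_split
  rw [Set.disjoint_left] at hdisj
  have hSne : S.Nonempty := by
    by_contra h
    rw [Set.not_nonempty_iff_eq_empty] at h
    exact small_of_finite (h ▸ Set.finite_empty) hS
  obtain ⟨o, ho⟩ := hSne
  classical
  obtain ⟨f, hf, hfC⟩ := hC.binary (fun x y => if y = o then x else y) hS'
  have hf₁ : ∀ x ∈ S, f x o = x := fun x hx => by rw [hf x hx o ho, if_pos rfl]
  have hf₂ : ∀ x ∈ S, f o x = x := fun x hx => by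
    rw [hf o ho x hx]
    split_ifs with h
    · exact h.symm
    · rfl
  have hq₁ : ∀ c, (fun x => f x c) ∈ setE X := fun c => by
    -- Replacing c by o on S turns the section into the identity there and leaves it unchanged
    -- elsewhere.
    obtain ⟨b, hb, hb₁, hb₂⟩ := hind o c
    exact mem_setE_of_mix hC hne hS hS' (hfC id (id_mem_unary C) _ (hconst c))
      (hfC id (id_mem_unary C) b hb) (fun x hx => by simp [hb₁ x hx, hf₁ x hx])
      (fun x hx => by simp [hb₂ x hx])
  have hq₂ : ∀ c, (fun x => f c x) ∈ setE X := fun c => by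
    obtain ⟨b, hb, hb₁, hb₂⟩ := hind o c
    exact mem_setE_of_mix hC hne hS hS' (hfC _ (hconst c) id (id_mem_unary C))
      (hfC b hb id (id_mem_unary C)) (fun x hx => by simp [hb₁ x hx, hf₂ x hx])
      (fun x hx => by simp [hb₂ x hx])
  have hcl : CoLarge S₂ := hl₁.mono fun x hx hx' => hdisj hx hx'
  have hesc : ∀ q ∈ setE X, ∃ x, q x ∉ S₂ := by
    intro q hq
    by_contra! h
    refine not_mem_setE.2 (Large.mono hcl ?_) hq
    rintro x hx ⟨y, rfl⟩
    exact hx (h y)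
  have hu : ∀ x, ∃ y, f x y ∉ S₂ ∧ (x ∈ S₁ → y = o) := fun x => by
    by_cases hx : x ∈ S₁
    · exact ⟨o, by rw [hf₁ x (hS₁ hx)]; exact hdisj hx, fun _ => rfl⟩
    · obtain ⟨y, hy⟩ := hesc _ (hq₂ x)
      exact ⟨y, hy, fun h => (hx h).elim⟩
  have hv : ∀ y, ∃ x, f x y ∉ S₂ := fun y => hesc _ (hq₁ y)
  choose u hu hu' using hu
  choose v hv using hv
  have hc : #X = #(X ⊕ X) := by simp [add_eq_self (aleph0_le_mk X)]
  obtain ⟨φ⟩ := Cardinal.eq.1 hc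
  -- The curve runs through all (x, u x) and all (v y, y). Since u is o on S₁, its f-values cover
  -- S₁.
  have he₁ : (fun t => Sum.elim id v (φ t)) ∈ setE X :=
    mem_setE_of_surjective fun x => ⟨φ.symm (.inl x), by simp⟩
  have he₂ : (fun t => Sum.elim u id (φ t)) ∈ setE X :=
    mem_setE_of_surjective fun x => ⟨φ.symm (.inr x), by simp⟩
  refine hne (eq_top_of_large_coLarge_range hC (hfC _ (hE he₁) _ (hE he₂)) ?_ ?_)
  · refine hl₁.mono fun x hx => ⟨φ.symm (.inl x), ?_⟩
    simp [hu' x hx, hf₁ x (hS₁ hx)]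
  · refine hl₂.mono ?_
    rintro x hx ⟨t, rfl⟩
    rcases h : φ t with x | y
    · simp only [h, Sum.elim_inl, id] at hx
      exact hu x hx
    · simp only [h, Sum.elim_inr, id] at hx
      exact hv y hx

theorem isCoatom_pol_setF : IsCoatom (pol (setF X)) := by
  refine ⟨pol_setF_ne_top, fun C hC => ?_⟩
  have hF := setF_subset_unary_pol_setF.trans (unary_mono hC.le)
  obtain ⟨k, hk, hkF⟩ := exists_not_mem_of_not_le_pol hF hC.not_ge
  exact eq_top_of_setE_subset (coLargeApprox_pol_setF.mono hC.le)
    (fun e he => hF (.inl he)) hk hkF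

end

section

variable {X : Type u}

/-! ### Symmetric precomplete clones -/

theorem conj_mem_unary {C : Clone X} (hC : IsSymmetric C) (γ : Equiv.Perm X) {u : X → X}
    (hu : u ∈ unary C) : γ ∘ u ∘ γ.symm ∈ unary C := by
  have : (⟨1, fun x => γ (u (γ.symm (x 0)))⟩ : Operation X) ∈
      {h | ∃ f ∈ C.carrier, ∃ γ : Equiv.Perm X, h = conj γ f} := ⟨_, hu, γ.symm, rfl⟩
  rw [← hC] at this
  exact this

theorem Precomplete.eq_pol {C : Clone X} (hC : Precomplete C) {G : Set (X → X)}
    (hle : C ≤ pol G) (hG : pol G ≠ ⊤) : C = pol G := by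
  rcases hle.eq_or_lt with h | h
  · exact h
  · exact (hG (hC.2 _ h)).elim

theorem pol_ne_top {G : Set (X → X)} {g u : X → X} (hg : g ∈ G) (hu : u ∘ g ∉ G) :
    pol G ≠ ⊤ := fun h =>
  hu ((mem_unary_pol (u := u)).1 (eq_top_iff_forall.1 h 1 fun x => u (x 0)) g hg)

/-- The functions which are eventually carried into the clone by composition from the right with
its surjective unary members. -/
def eventual (C : Clone X) : Set (X → X) :=
  {d | ∀ p ∈ unary C, Function.Surjective p →
    ∃ q ∈ unary C, Function.Surjective q ∧ d ∘ p ∘ q ∈ unary C}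

/-- The surjections needed by the finitely many arguments are composed one after another; later ones
do not spoil what earlier ones achieved. -/
theorem le_pol_eventual (C : Clone X) : C ≤ pol (eventual C) := by
  rintro ⟨n, f⟩ hf (d : Fin (n : ℕ) → X → X) hd p hp hps
  have key : ∀ s : Finset (Fin (n : ℕ)), ∃ q ∈ unary C, Function.Surjective q ∧
      ∀ i ∈ s, d i ∘ p ∘ q ∈ unary C := by
    classical
    intro s
    induction s using Finset.induction_on with
    | empty => exact ⟨id, id_mem_unary C, Function.surjective_id, by simp⟩
    | insert a s _ ih =>
      obtain ⟨q, hq, hqs, h⟩ := ih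
      obtain ⟨r, hr, hrs, h'⟩ := hd a (p ∘ q) (comp_mem_unary hp hq) (hps.comp hqs)
      refine ⟨q ∘ r, comp_mem_unary hq hr, hqs.comp hrs, fun i hi => ?_⟩
      rcases Finset.mem_insert.1 hi with rfl | hi
      · exact h'
      · exact comp_mem_unary (u := d i ∘ p ∘ q) (h i hi) hr
  obtain ⟨q, hq, hqs, h⟩ := key Finset.univ
  exact ⟨q, hq, hqs, C.comp_unary hf fun i => h i (Finset.mem_univ i)⟩

theorem id_mem_eventual (C : Clone X) : id ∈ eventual C := fun _ hp _ =>
  ⟨id, id_mem_unary C, Function.surjective_id, hp⟩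

/-- Two functions are almost equal if they differ on a small set only. -/
def AlmostEq (f g : X → X) : Prop :=
  Small {x | f x ≠ g x}

/-- The functions which composed with `q` almost agree with a member of `G`. -/
def almostCarried (q : X → X) (G : Set (X → X)) : Set (X → X) :=
  {d | ∃ g ∈ G, AlmostEq (d ∘ q) g}

/-- Two functions agreeing on a set with large complement, and all of whose fibres are large on
that complement, differ by a permutation which fixes the set. -/
theorem exists_perm_of_large_fibres {p v : X → X} {A : Set X} (hpv : ∀ x ∈ A, p x = v x)
    (hp : ∀ y, Large {x | x ∉ A ∧ p x = y}) (hv : ∀ y, Large {x | x ∉ A ∧ v x = y}) :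
    ∃ π : Equiv.Perm X, (∀ x ∈ A, π x = x) ∧ p ∘ π = v := by
  have hfib : ∀ (w : X → X) (y : X), Large {x | x ∉ A ∧ w x = y} →
      #{x : {x // x ∉ A} // w x = y} = #X := by
    intro w y hw
    rw [← hw]
    exact mk_congr (Equiv.subtypeSubtypeEquivSubtypeInter (fun x => x ∉ A) fun x => w x = y)
  have : ∀ y, Nonempty ({x : {x // x ∉ A} // v x = y} ≃ {x : {x // x ∉ A} // p x = y}) :=
    fun y => Cardinal.eq.1 ((hfib v y (hv y)).trans (hfib p y (hp y)).symm)
  let e := fun y => (this y).some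
  let σ : Equiv.Perm {x // x ∉ A} :=
    Equiv.ofFiberEquiv (f := fun x : {x // x ∉ A} => v x) (g := fun x => p x) fun y => e y
  have hσ : ∀ x, p (σ x) = v x := fun x => Equiv.ofFiberEquiv_map (fun y => e y) x
  classical
  refine ⟨Equiv.Perm.ofSubtype σ, fun x hx =>
    Equiv.Perm.ofSubtype_apply_of_not_mem σ (not_not.2 hx), ?_⟩
  ext x
  by_cases hx : x ∈ A
  · rw [Function.comp_apply, Equiv.Perm.ofSubtype_apply_of_not_mem σ (not_not.2 hx), hpv x hx]
  · rw [Function.comp_apply, Equiv.Perm.ofSubtype_apply_of_mem σ hx, hσ]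

variable [Infinite X]

theorem AlmostEq.refl (f : X → X) : AlmostEq f f := by
  simpa [AlmostEq] using small_of_finite (X := X) Set.finite_empty

theorem le_pol_almostCarried {C : Clone X} {G : Set (X → X)} (h : C ≤ pol G) (q : X → X) :
    C ≤ pol (almostCarried q G) := by
  rintro ⟨n, f⟩ hf (d : Fin (n : ℕ) → X → X) hd
  choose g hg hdg using hd
  refine ⟨_, h hf g hg, ?_⟩
  refine (Small.biUnion_finset Finset.univ (A := fun i => {x | (d i ∘ q) x ≠ g i x})
    fun i _ => hdg i).mono fun x hx => ?_
  by_contra hx'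
  simp only [Finset.mem_univ, Set.iUnion_true, Set.mem_iUnion, not_exists, Set.mem_ofPred_eq,
    not_not] at hx'
  exact hx (congrArg f (funext fun i => hx' i))

theorem AlmostEq.large_range {f g : X → X} (h : AlmostEq f g) (hf : Large (Set.range f)) :
    Large (Set.range g) := by
  refine (hf.diff (Small.image h f)).mono ?_
  rintro _ ⟨⟨x, rfl⟩, hx⟩
  exact ⟨x, by_contra fun hne => hx ⟨x, fun h => hne h.symm, rfl⟩⟩

theorem AlmostEq.coLarge_range {f g : X → X} (h : AlmostEq f g) (hf : CoLarge (Set.range f)) :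
    CoLarge (Set.range g) := by
  refine (Large.diff hf (Small.image h g)).mono ?_
  rintro _ ⟨hx, hx'⟩ ⟨x, rfl⟩
  exact hx' ⟨x, fun h => hx ⟨x, h⟩, rfl⟩

/-- A symmetric precomplete clone with the co-large approximation property contains all
permutations with a large set of fixed points. -/
theorem perm_mem_unary {C : Clone X} (hs : IsSymmetric C) (hp : Precomplete C)
    (hC : CoLargeApprox C.carrier) {π : Equiv.Perm X} (hπ : Large {x | π x = x}) :
    ⇑π ∈ unary C := by
  have heq : C = pol (eventual C) := by
    refine hp.eq_pol (le_pol_eventual C) ?_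
    obtain ⟨ι, hι, hr⟩ := exists_injective_coLarge (X := X)
    refine pol_ne_top (id_mem_eventual C) (u := ι) fun h => hp.1 ?_
    obtain ⟨q, hq, hqs, h⟩ := h id (id_mem_unary C) Function.surjective_id
    have hrange : Set.range (ι ∘ q) = Set.range ι := hqs.range_comp ι
    exact eq_top_of_large_coLarge_range hC (u := ι ∘ q) h
      (hrange ▸ large_range_of_injective hι) (hrange ▸ hr)
  obtain ⟨r, hr, hrs, hrπ⟩ : ∃ r ∈ unary C, Function.Surjective r ∧ π ∘ r ∈ unary C := by
    obtain ⟨A, B, hA, hB, hAB, hu, hlA, hlB⟩ := hπ.exists_split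
    rw [Set.disjoint_left] at hAB
    obtain ⟨φ, hφ⟩ := hlB.exists_surj
    obtain ⟨o⟩ := (inferInstance : Nonempty X)
    classical
    -- r is constant on the points moved by π, so r ∘ π = r and the conjugate of r by π is just π ∘
    -- r.
    obtain ⟨r, hr, hr'⟩ := hC.unary (fun x => if x ∈ B then φ x else o) (S := Aᶜ)
      (by rwa [CoLarge, compl_compl])
    have hinv : r ∘ π = r := by
      ext x
      by_cases hx : π x = x
      · simp [hx]
      · have h₁ : x ∉ A ∪ B := hu ▸ hx
        have h₂ : π x ∉ A ∪ B := hu ▸ fun h => hx (π.injective h)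
        rw [Set.mem_union, not_or] at h₁ h₂
        rw [Function.comp_apply, hr' _ h₁.1, hr' _ h₂.1, if_neg h₁.2, if_neg h₂.2]
    refine ⟨r, hr, fun y => ?_, ?_⟩
    · obtain ⟨x, hx, rfl⟩ := hφ y
      exact ⟨x, by rw [hr' x fun h => hAB h hx, if_pos hx]⟩
    · have := conj_mem_unary hs π hr
      have h' : r ∘ π.symm = r := by
        ext x
        have := congrFun hinv (π.symm x)
        simpa using this.symm
      rwa [h'] at this
  rw [heq]
  refine mem_unary_pol.2 fun d hd p hp hps => ?_
  obtain ⟨q, hq, hqs, h⟩ := hd p hp hps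
  refine ⟨q ∘ r, comp_mem_unary hq hr, hqs.comp hrs, ?_⟩
  have : (⇑π ∘ d) ∘ p ∘ q ∘ r = (⇑π ∘ (d ∘ p ∘ q) ∘ ⇑π.symm) ∘ (⇑π ∘ r) := by
    ext x; simp
  rw [this]
  exact comp_mem_unary (conj_mem_unary hs π h) hrπ

/-- An approximation p from C agrees with s ∘ fst except over D. Agreement over B makes all fibres
of both large outside the part over A, so they differ by a permutation fixing that part, which lies
in C. -/
theorem comp_fst_mem_unary {C : Clone X} (hs : IsSymmetric C) (hp : Precomplete C)
    (hC : CoLargeApprox C.carrier) (β : X ≃ X × X) {s : X → X} (hsurj : Function.Surjective s) :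
    (fun x => s (β x).1) ∈ unary C := by
  obtain ⟨A, B, D, hAB, hAD, hBD, -, hA, hB, hD⟩ := exists_three_large (X := X)
  rw [Set.disjoint_left] at hAB hAD hBD
  have hlarge : ∀ (T : Set X), Large T → ∀ t, Large {x | (β x).1 = t ∧ (β x).2 ∈ T} := by
    intro T hT t
    refine (hT.image (f := fun b => β.symm (t, b)) fun a _ b _ h => ?_).mono ?_
    · simpa using β.symm.injective h
    · rintro _ ⟨b, hb, rfl⟩
      simpa using hb
  obtain ⟨o⟩ := (inferInstance : Nonempty X)
  obtain ⟨p, hpC, hp'⟩ := hC.unary (fun x => s (β x).1) (S := {x | (β x).2 ∉ D})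
    ((hlarge D hD o).mono fun x hx h => h hx.2)
  have hfib : ∀ w : X → X, (∀ x, (β x).2 ∉ D → w x = s (β x).1) →
      ∀ y, Large {x | x ∉ {x | (β x).2 ∈ A} ∧ w x = y} := by
    intro w hw y
    obtain ⟨t, rfl⟩ := hsurj y
    refine (hlarge B hB t).mono fun x hx => ⟨fun h => hAB h hx.2, ?_⟩
    rw [hw x (hBD hx.2), hx.1]
  obtain ⟨π, hπ, hpπ⟩ := exists_perm_of_large_fibres (p := p) (v := fun x => s (β x).1)
    (A := {x | (β x).2 ∈ A}) (fun x hx => hp' x (hAD hx)) (hfib p hp')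
    (hfib _ fun _ _ => rfl)
  rw [← hpπ]
  exact comp_mem_unary hpC (perm_mem_unary hs hp hC
    ((hlarge A hA o).mono fun x hx => hπ x hx.2))

/-- Carrying along q twice suffices: the first time captures all surjections, the second all almost
surjective functions. The resulting proper polymorphism clone contains C, so equals it. -/
theorem setE_subset_unary {C : Clone X} (hs : IsSymmetric C) (hp : Precomplete C)
    (hC : CoLargeApprox C.carrier) : setE X ⊆ unary C := by
  have hc : #X = #(X × X) := by simp [mul_eq_self (aleph0_le_mk X)]
  obtain ⟨β⟩ := Cardinal.eq.1 hc
  let q : X → X := fun x => (β x).1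
  have hq : Function.Surjective q := fun y => ⟨β.symm (y, y), by simp [q]⟩
  let G := almostCarried q (unary C)
  have hsurj : ∀ s : X → X, Function.Surjective s → s ∈ G := fun s h =>
    ⟨_, comp_fst_mem_unary hs hp hC β h, AlmostEq.refl _⟩
  have hE : setE X ⊆ almostCarried q G := by
    intro e he
    rw [mem_setE] at he
    classical
    -- A small change of e ∘ q makes it surjective: each missing value is hit at itself, and each e
    -- t is still attained because the fibre of q over t is large.
    refine ⟨fun x => if x ∈ Set.range e then e (q x) else x, hsurj _ fun y => ?_,
      he.mono fun x hx hx' => hx ?_⟩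
    · by_cases hy : y ∈ Set.range e
      · obtain ⟨t, rfl⟩ := hy
        have hl : Large {x | q x = t} := by
          refine (large_range_of_injective (f := fun b => β.symm (t, b)) fun a b h => ?_).mono ?_
          · simpa using β.symm.injective h
          · rintro _ ⟨b, rfl⟩
            simp [q]
        by_contra! h
        refine Small.mono he (fun x hx hx' => ?_) hl
        exact h x (by rw [if_pos hx', show q x = t from hx])
      · exact ⟨y, if_neg hy⟩
    · simp [hx']
  have heq : C = pol (almostCarried q G) := by
    refine hp.eq_pol (le_pol_almostCarried (le_pol_almostCarried (le_pol_unary C) q) q) ?_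
    obtain ⟨ι, hι, hr⟩ := exists_injective_coLarge (X := X)
    refine pol_ne_top (hE (mem_setE_of_surjective Function.surjective_id)) (u := ι)
      fun h => hp.1 ?_
    obtain ⟨g, ⟨d, hd, hgd⟩, hg⟩ := h
    have h₁ : Set.range ((ι ∘ id) ∘ q) = Set.range ι := hq.range_comp ι
    have h₂ : Set.range (g ∘ q) = Set.range g := hq.range_comp g
    exact eq_top_of_large_coLarge_range hC hd
      (hgd.large_range (h₂ ▸ hg.large_range (h₁ ▸ large_range_of_injective hι)))
      (hgd.coLarge_range (h₂ ▸ hg.coLarge_range (h₁ ▸ hr)))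
  intro e he
  rw [heq]
  refine mem_unary_pol.2 fun d hd => ?_
  by_cases hdE : d ∈ setE X
  · exact hE (setE_comp he hdE)
  -- On the co-large range of d, e can be replaced by a member of C, which preserves the carried
  -- set.
  · obtain ⟨j, hj, hj'⟩ := hC.unary e (not_mem_setE.1 hdE)
    rw [heq] at hj
    have : e ∘ d = j ∘ d := funext fun x => (hj' _ ⟨x, rfl⟩).symm
    rw [this]
    exact mem_unary_pol.1 hj d hd

theorem eq_pol_of_symmetric_precomplete {C : Clone X} (hs : IsSymmetric C) (hp : Precomplete C)
    (hC : CoLargeApprox C.carrier) : C = pol (setE X) ∨ C = pol (setF X) := by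
  have hE := setE_subset_unary hs hp hC
  by_contra! h
  obtain ⟨k, hk, hkE⟩ := exists_not_mem_of_not_le_pol hE fun hle =>
    h.1 (hp.eq_pol hle pol_setE_ne_top)
  have hF : setF X ⊆ unary C := by
    rintro g (hg | ⟨b, hb⟩)
    · exact hE hg
    · obtain ⟨j, hj, hj'⟩ := hC.unary (fun _ => b) (not_mem_setE.1 hkE)
      have : g = j ∘ k := funext fun x => by rw [hb, Function.comp_apply, hj' _ ⟨x, rfl⟩]
      exact this ▸ comp_mem_unary hj hk
  obtain ⟨l, hl, hlF⟩ := exists_not_mem_of_not_le_pol hF fun hle =>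
    h.2 (hp.eq_pol hle pol_setF_ne_top)
  exact hp.1 (eq_top_of_setE_subset hC hE hl hlF)

end

end SymmetricClones

theorem mainTheorem4 {X : Type*} [Infinite X] (C : SymmetricClones.Clone X) :
    (SymmetricClones.IsSymmetric C ∧ SymmetricClones.Precomplete C ∧
        SymmetricClones.CoLargeApprox C.carrier) ↔
      (C = SymmetricClones.pol (SymmetricClones.setE X) ∨
        C = SymmetricClones.pol (SymmetricClones.setF X)) := by
  constructor
  · rintro ⟨hs, hp, hC⟩
    exact SymmetricClones.eq_pol_of_symmetric_precomplete hs hp hC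
  · rintro (rfl | rfl)
    · exact ⟨SymmetricClones.isSymmetric_pol_setE, SymmetricClones.isCoatom_pol_setE,
        SymmetricClones.coLargeApprox_pol_setE⟩
    · exact ⟨SymmetricClones.isSymmetric_pol_setF, SymmetricClones.isCoatom_pol_setF,
        SymmetricClones.coLargeApprox_pol_setF⟩
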